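/- Let $G$ be a totally disconnected, locally compact group and let $\alpha$ be an automorphism of $G$ (a group automorphism that is also a homeomorphism). For a compact open subgroup $V\le G$ put $$V_+=\bigcap_{k\ge 0}\alpha^k(V),\quad V_-=\bigcap_{k\ge 0}\alpha^{-k}(V),\quad V_{++}=\bigcup_{k\ge 0}\alpha^k(V_+),\quad V_{--}=\bigcup_{k\ge 0}\alpha^{-k}(V_-).$$ Call $V$ tidy above for $\alpha$ if $V=V_+V_-$, tidy below for $\alpha$ if $V_{++}$ and $V_{--}$ are both closed in $G$, and tidy for $\alpha$ if it is both tidy above and tidy below. Let $\mathrm{nub}(\alpha)$ be the intersection of all compact open subgroups of $G$ that are tidy for $\alpha$. Then a compact open subgroup $V$ of $G$ is tidy below for $\alpha$ if and only if $\mathrm{nub}(\alpha)\le V$. In particular, a compact open subgroup of $G$ that contains $\mathrm{nub}(\alpha)$ and is tidy above for $\alpha$ is tidy for $\alpha$. -/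

import Mathlib

open scoped Pointwise

namespace TDLC

variable {G : Type*} [Group G] [TopologicalSpace G]

/-- The automorphism of the abstract group `G` underlying `α`; its integer powers `α ^ k` are
taken in the group `MulAut G`. -/
def toAut (α : G ≃ₜ* G) : MulAut G := α.toMulEquiv

/-- `V₊ = ⋂_{k ≥ 0} α^k(V)`. -/
def plus (α : G ≃ₜ* G) (V : Subgroup G) : Subgroup G :=
  ⨅ k : ℕ, V.map (toAut α ^ (k : ℤ)).toMonoidHom

/-- `V₋ = ⋂_{k ≥ 0} α^{-k}(V)`. -/
def minus (α : G ≃ₜ* G) (V : Subgroup G) : Subgroup G :=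
  ⨅ k : ℕ, V.map (toAut α ^ (-(k : ℤ))).toMonoidHom

/-- `V₊₊ = ⋃_{k ≥ 0} α^k(V₊)`. -/
def plusPlus (α : G ≃ₜ* G) (V : Subgroup G) : Set G :=
  ⋃ k : ℕ, (toAut α ^ (k : ℤ)) '' (plus α V : Set G)

/-- `V₋₋ = ⋃_{k ≥ 0} α^{-k}(V₋)`. -/
def minusMinus (α : G ≃ₜ* G) (V : Subgroup G) : Set G :=
  ⋃ k : ℕ, (toAut α ^ (-(k : ℤ))) '' (minus α V : Set G)

/-- `V` is tidy above for `α`: `V = V₊ V₋`. -/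
def TidyAbove (α : G ≃ₜ* G) (V : Subgroup G) : Prop :=
  (V : Set G) = (plus α V : Set G) * (minus α V : Set G)

/-- `V` is tidy below for `α`: both `V₊₊` and `V₋₋` are closed. -/
def TidyBelow (α : G ≃ₜ* G) (V : Subgroup G) : Prop :=
  IsClosed (plusPlus α V) ∧ IsClosed (minusMinus α V)

/-- `V` is tidy for `α`: tidy above and tidy below. -/
def Tidy (α : G ≃ₜ* G) (V : Subgroup G) : Prop :=
  TidyAbove α V ∧ TidyBelow α V

/-- The nub of `α`: the intersection of all compact open subgroups that are tidy for `α`. -/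
def nub (α : G ≃ₜ* G) : Subgroup G :=
  sInf {V : Subgroup G | IsCompact (V : Set G) ∧ IsOpen (V : Set G) ∧ Tidy α V}

end TDLC

/-! The truncations `⋂_{0 ≤ k ≤ n} α^k(V)` have the same `V₊₊` and `V₋₋` as `V`, and some truncation
is tidy above (`exists_tidyAbove_truncation`). So a tidy below `V` contains a tidy subgroup, hence
the nub.

Conversely, compact open tidy below subgroups are stable under intersection, and their intersection
lies in the nub. If `nub α ≤ V`, compactness puts one of them, hence a tidy `U`, inside `V`. A Baire
argument in the closed group `U₋₋` then gives `V₊₊ ∩ U ⊆ U₊` (`Tidy.plusPlus_inter_subset`). As `U₊`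
is closed and lies in `V₊₊`, `V₊₊` is closed near `1`, hence closed. Replacing `α` by its inverse
handles `V₋₋`. -/

namespace TDLC

/-! ### Orbit descriptions, symmetry under inversion, and truncations. -/

section Basic

variable {G : Type*} [Group G] [TopologicalSpace G]

lemma toAut_zpow_apply (α : G ≃ₜ* G) (k : ℕ) (x : G) : (toAut α ^ (k : ℤ)) x = α^[k] x := by
  rw [zpow_natCast]
  induction k generalizing x with
  | zero => rfl
  | succ k ih => rw [pow_succ, MulAut.mul_apply, ih, Function.iterate_succ_apply]; rfl

lemma iterate_symm_iterate (α : G ≃ₜ* G) (k : ℕ) (x : G) : α.symm^[k] (α^[k] x) = x :=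
  Function.LeftInverse.iterate α.symm_apply_apply k x

lemma iterate_iterate_symm (α : G ≃ₜ* G) (k : ℕ) (x : G) : α^[k] (α.symm^[k] x) = x :=
  Function.LeftInverse.iterate α.apply_symm_apply k x

lemma iterate_iterate_symm_of_le (α : G ≃ₜ* G) {j k : ℕ} (h : j ≤ k) (x : G) :
    α^[j] (α.symm^[k] x) = α.symm^[k - j] x := by
  obtain ⟨i, rfl⟩ := Nat.exists_eq_add_of_le h
  rw [Function.iterate_add_apply, iterate_iterate_symm, Nat.add_sub_cancel_left]

lemma iterate_iterate_symm_of_ge (α : G ≃ₜ* G) {j k : ℕ} (h : k ≤ j) (x : G) :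
    α^[j] (α.symm^[k] x) = α^[j - k] x := by
  obtain ⟨i, rfl⟩ := Nat.exists_eq_add_of_le h
  rw [Nat.add_comm, Function.iterate_add_apply, iterate_iterate_symm, Nat.add_sub_cancel_right]

lemma toAut_zpow_neg_apply (α : G ≃ₜ* G) (k : ℕ) (x : G) :
    (toAut α ^ (-(k : ℤ))) x = α.symm^[k] x := by
  rw [zpow_neg, MulAut.inv_apply, MulEquiv.symm_apply_eq, toAut_zpow_apply, iterate_iterate_symm]

lemma mem_map_zpow (α : G ≃ₜ* G) (V : Subgroup G) (k : ℕ) (x : G) :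
    x ∈ V.map (toAut α ^ (k : ℤ)).toMonoidHom ↔ α.symm^[k] x ∈ V := by
  constructor
  · rintro ⟨y, hy, rfl⟩
    change α.symm^[k] ((toAut α ^ (k : ℤ)) y) ∈ V
    rwa [toAut_zpow_apply, iterate_symm_iterate]
  · intro h
    refine ⟨_, h, ?_⟩
    change (toAut α ^ (k : ℤ)) _ = x
    rw [toAut_zpow_apply, iterate_iterate_symm]

lemma mem_map_zpow_neg (α : G ≃ₜ* G) (V : Subgroup G) (k : ℕ) (x : G) :
    x ∈ V.map (toAut α ^ (-(k : ℤ))).toMonoidHom ↔ α^[k] x ∈ V := by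
  constructor
  · rintro ⟨y, hy, rfl⟩
    change α^[k] ((toAut α ^ (-(k : ℤ))) y) ∈ V
    rwa [toAut_zpow_neg_apply, iterate_iterate_symm]
  · intro h
    refine ⟨_, h, ?_⟩
    change (toAut α ^ (-(k : ℤ))) _ = x
    rw [toAut_zpow_neg_apply, iterate_symm_iterate]

lemma mem_plus {α : G ≃ₜ* G} {V : Subgroup G} {x : G} :
    x ∈ plus α V ↔ ∀ k : ℕ, α.symm^[k] x ∈ V := by
  simp only [plus, Subgroup.mem_iInf, mem_map_zpow]

lemma mem_minus {α : G ≃ₜ* G} {V : Subgroup G} {x : G} :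
    x ∈ minus α V ↔ ∀ k : ℕ, α^[k] x ∈ V := by
  simp only [minus, Subgroup.mem_iInf, mem_map_zpow_neg]

lemma minus_symm (α : G ≃ₜ* G) (V : Subgroup G) : minus α.symm V = plus α V := by
  ext x; rw [mem_minus, mem_plus]

lemma plus_symm (α : G ≃ₜ* G) (V : Subgroup G) : plus α.symm V = minus α V :=
  (minus_symm α.symm V).symm

lemma plus_le (α : G ≃ₜ* G) (V : Subgroup G) : plus α V ≤ V := fun _ hx => mem_plus.1 hx 0

lemma minus_le (α : G ≃ₜ* G) (V : Subgroup G) : minus α V ≤ V := fun _ hx => mem_minus.1 hx 0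

lemma iterate_symm_mem_plus {α : G ≃ₜ* G} {V : Subgroup G} {x : G} (hx : x ∈ plus α V) (m : ℕ) :
    α.symm^[m] x ∈ plus α V :=
  mem_plus.2 fun k => by rw [← Function.iterate_add_apply]; exact mem_plus.1 hx _

lemma mem_plusPlus {α : G ≃ₜ* G} {V : Subgroup G} {x : G} :
    x ∈ plusPlus α V ↔ ∃ n : ℕ, ∀ k ≥ n, α.symm^[k] x ∈ V := by
  simp only [plusPlus, Set.mem_iUnion, Set.mem_image, SetLike.mem_coe, mem_plus, toAut_zpow_apply]
  constructor
  · rintro ⟨n, y, hy, rfl⟩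
    refine ⟨n, fun k hk => ?_⟩
    have := hy (k - n)
    rwa [← iterate_iterate_symm_of_ge α.symm hk] at this
  · rintro ⟨n, hn⟩
    refine ⟨n, α.symm^[n] x, fun k => ?_, iterate_iterate_symm α n x⟩
    rw [← Function.iterate_add_apply]
    exact hn _ (Nat.le_add_left _ _)

lemma plusPlus_symm (α : G ≃ₜ* G) (V : Subgroup G) : plusPlus α.symm V = minusMinus α V := by
  simp only [plusPlus, minusMinus, plus_symm]
  refine Set.iUnion_congr fun k => Set.image_congr fun x _ => ?_
  rw [toAut_zpow_apply, toAut_zpow_neg_apply]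

lemma minusMinus_symm (α : G ≃ₜ* G) (V : Subgroup G) : minusMinus α.symm V = plusPlus α V :=
  (plusPlus_symm α.symm V).symm

lemma mem_minusMinus {α : G ≃ₜ* G} {V : Subgroup G} {x : G} :
    x ∈ minusMinus α V ↔ ∃ n : ℕ, ∀ k ≥ n, α^[k] x ∈ V := by
  rw [← plusPlus_symm]; exact mem_plusPlus

lemma TidyBelow.symm {α : G ≃ₜ* G} {V : Subgroup G} (h : TidyBelow α V) : TidyBelow α.symm V := by
  rw [TidyBelow, plusPlus_symm, minusMinus_symm]; exact ⟨h.2, h.1⟩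

lemma TidyAbove.symm {α : G ≃ₜ* G} {V : Subgroup G} (h : TidyAbove α V) : TidyAbove α.symm V := by
  rw [TidyAbove, plus_symm, minus_symm]
  have h' := congrArg (·⁻¹) (show (V : Set G) = _ from h)
  simpa [mul_inv_rev] using h'

lemma Tidy.symm {α : G ≃ₜ* G} {V : Subgroup G} (h : Tidy α V) : Tidy α.symm V :=
  ⟨h.1.symm, h.2.symm⟩

/-- The elements whose `α`-orbit lies in `V` from time `n` on. -/
def eventuallyIn (α : G ≃ₜ* G) (V : Subgroup G) (n : ℕ) : Subgroup G where
  carrier := {x | ∀ k ≥ n, α^[k] x ∈ V}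
  one_mem' k _ := by rw [iterate_map_one]; exact V.one_mem
  mul_mem' ha hb k hk := by rw [iterate_map_mul]; exact V.mul_mem (ha k hk) (hb k hk)
  inv_mem' ha k hk := by rw [iterate_map_inv]; exact V.inv_mem (ha k hk)

lemma mem_eventuallyIn {α : G ≃ₜ* G} {V : Subgroup G} {n : ℕ} {x : G} :
    x ∈ eventuallyIn α V n ↔ ∀ k ≥ n, α^[k] x ∈ V := Iff.rfl

lemma eventuallyIn_mono (α : G ≃ₜ* G) (V : Subgroup G) : Monotone (eventuallyIn α V) :=
  fun _ _ hmn _ hx k hk => hx k (hmn.trans hk)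

lemma continuous_iterate (α : G ≃ₜ* G) (k : ℕ) : Continuous α^[k] :=
  α.continuous.iterate k

lemma isClosed_eventuallyIn (α : G ≃ₜ* G) {V : Subgroup G} (hV : IsClosed (V : Set G)) (n : ℕ) :
    IsClosed (eventuallyIn α V n : Set G) := by
  have : (eventuallyIn α V n : Set G) = ⋂ k ≥ n, α^[k] ⁻¹' V := by
    ext x; simp [mem_eventuallyIn]
  rw [this]
  exact isClosed_biInter fun k _ => hV.preimage (continuous_iterate α k)

lemma isClosed_plus (α : G ≃ₜ* G) {V : Subgroup G} (hV : IsClosed (V : Set G)) :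
    IsClosed (plus α V : Set G) := by
  have : (plus α V : Set G) = eventuallyIn α.symm V 0 := by
    ext x; simp [mem_eventuallyIn, mem_plus]
  rw [this]
  exact isClosed_eventuallyIn _ hV _

/-- `V₋₋` as a subgroup. -/
def minusMinusSubgroup (α : G ≃ₜ* G) (V : Subgroup G) : Subgroup G := ⨆ n, eventuallyIn α V n

lemma mem_minusMinusSubgroup {α : G ≃ₜ* G} {V : Subgroup G} {x : G} :
    x ∈ minusMinusSubgroup α V ↔ ∃ n, x ∈ eventuallyIn α V n :=
  Subgroup.mem_iSup_of_directed (eventuallyIn_mono α V).directed_le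

lemma coe_minusMinusSubgroup (α : G ≃ₜ* G) (V : Subgroup G) :
    (minusMinusSubgroup α V : Set G) = minusMinus α V := by
  ext x
  rw [SetLike.mem_coe, mem_minusMinusSubgroup, mem_minusMinus]
  rfl

lemma plusPlus_inf (α : G ≃ₜ* G) (U V : Subgroup G) :
    plusPlus α (U ⊓ V) = plusPlus α U ∩ plusPlus α V := by
  ext x
  simp only [Set.mem_inter_iff, mem_plusPlus, Subgroup.mem_inf]
  constructor
  · rintro ⟨n, h⟩
    exact ⟨⟨n, fun k hk => (h k hk).1⟩, ⟨n, fun k hk => (h k hk).2⟩⟩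
  · rintro ⟨⟨m, hm⟩, ⟨n, hn⟩⟩
    exact ⟨max m n, fun k hk => ⟨hm k (le_of_max_le_left hk), hn k (le_of_max_le_right hk)⟩⟩

lemma TidyBelow.inf {α : G ≃ₜ* G} {U V : Subgroup G} (hU : TidyBelow α U) (hV : TidyBelow α V) :
    TidyBelow α (U ⊓ V) := by
  refine ⟨?_, ?_⟩
  · rw [plusPlus_inf]; exact hU.1.inter hV.1
  · rw [← plusPlus_symm, plusPlus_inf, plusPlus_symm, plusPlus_symm]; exact hU.2.inter hV.2

lemma tidyBelow_top (α : G ≃ₜ* G) : TidyBelow α (⊤ : Subgroup G) := by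
  have h (β : G ≃ₜ* G) : plusPlus β (⊤ : Subgroup G) = Set.univ := by
    ext x; simp [mem_plusPlus]
  refine ⟨by rw [h]; exact isClosed_univ, by rw [← plusPlus_symm, h]; exact isClosed_univ⟩

/-- `⋂_{0 ≤ k ≤ n} α^k(V)`. -/
def truncation (α : G ≃ₜ* G) (V : Subgroup G) (n : ℕ) : Subgroup G where
  carrier := {x | ∀ k ≤ n, α.symm^[k] x ∈ V}
  one_mem' k _ := by rw [iterate_map_one]; exact V.one_mem
  mul_mem' ha hb k hk := by rw [iterate_map_mul]; exact V.mul_mem (ha k hk) (hb k hk)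
  inv_mem' ha k hk := by rw [iterate_map_inv]; exact V.inv_mem (ha k hk)

lemma mem_truncation {α : G ≃ₜ* G} {V : Subgroup G} {n : ℕ} {x : G} :
    x ∈ truncation α V n ↔ ∀ k ≤ n, α.symm^[k] x ∈ V := Iff.rfl

lemma truncation_le (α : G ≃ₜ* G) (V : Subgroup G) (n : ℕ) : truncation α V n ≤ V :=
  fun _ hx => hx 0 (Nat.zero_le n)

lemma plus_le_truncation (α : G ≃ₜ* G) (V : Subgroup G) (n : ℕ) : plus α V ≤ truncation α V n :=
  fun _ hx k _ => mem_plus.1 hx k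

lemma coe_truncation (α : G ≃ₜ* G) (V : Subgroup G) (n : ℕ) :
    (truncation α V n : Set G) = ⋂ k ∈ Set.Iic n, α.symm^[k] ⁻¹' V := by
  ext x; simp [mem_truncation]

lemma isOpen_truncation (α : G ≃ₜ* G) {V : Subgroup G} (hV : IsOpen (V : Set G)) (n : ℕ) :
    IsOpen (truncation α V n : Set G) := by
  rw [coe_truncation]
  exact (Set.finite_Iic n).isOpen_biInter fun k _ => hV.preimage (continuous_iterate α.symm k)

lemma isClosed_truncation (α : G ≃ₜ* G) {V : Subgroup G} (hV : IsClosed (V : Set G)) (n : ℕ) :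
    IsClosed (truncation α V n : Set G) := by
  rw [coe_truncation]
  exact isClosed_biInter fun k _ => hV.preimage (continuous_iterate α.symm k)

lemma plus_truncation (α : G ≃ₜ* G) (V : Subgroup G) (n : ℕ) :
    plus α (truncation α V n) = plus α V := by
  ext x
  simp only [mem_plus, mem_truncation]
  refine ⟨fun h k => h k 0 (Nat.zero_le n), fun h k j _ => ?_⟩
  rw [← Function.iterate_add_apply]
  exact h _

lemma plusPlus_truncation (α : G ≃ₜ* G) (V : Subgroup G) (n : ℕ) :
    plusPlus α (truncation α V n) = plusPlus α V := by
  simp only [plusPlus, plus_truncation]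

lemma minusMinus_truncation (α : G ≃ₜ* G) (V : Subgroup G) (n : ℕ) :
    minusMinus α (truncation α V n) = minusMinus α V := by
  ext x
  simp only [mem_minusMinus, mem_truncation]
  constructor
  · rintro ⟨m, h⟩
    exact ⟨m, fun k hk => h k hk 0 (Nat.zero_le n)⟩
  · rintro ⟨m, h⟩
    -- Truncating pulls back by at most `n` steps, so delaying the threshold by `n` suffices.
    refine ⟨m + n, fun k hk j hj => ?_⟩
    rw [show α^[k] x = α^[j] (α^[k - j] x) by
      rw [← Function.iterate_add_apply, Nat.add_sub_cancel' (by omega)], iterate_symm_iterate]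
    exact h _ (by omega)

lemma TidyBelow.tidyBelow_truncation {α : G ≃ₜ* G} {V : Subgroup G} (h : TidyBelow α V) (n : ℕ) :
    TidyBelow α (truncation α V n) := by
  rw [TidyBelow, plusPlus_truncation, minusMinus_truncation]; exact h

end Basic

/-! ### Compactness arguments producing tidy subgroups. -/

section TidyingAbove

variable {G : Type*} [Group G] [TopologicalSpace G] [IsTopologicalGroup G] [T2Space G]

/-- For large `n`, `α(⋂_{0 ≤ k ≤ n} α^k(V)) ⊆ α(V₊) V`. -/
lemma exists_truncation_subset (α : G ≃ₜ* G) {V : Subgroup G}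
    (hVc : IsCompact (V : Set G)) (hVo : IsOpen (V : Set G)) :
    ∃ n, ∀ x ∈ truncation α V n, ∃ y ∈ plus α V, α (y⁻¹ * x) ∈ V := by
  by_contra! hne
  let C : ℕ → Set G := fun n => truncation α V n ∩ ⋂ y ∈ plus α V, {x | α (y⁻¹ * x) ∉ V}
  have hclosed (n : ℕ) : IsClosed (C n) := by
    refine (isClosed_truncation α hVc.isClosed n).inter (isClosed_biInter fun y _ => ?_)
    exact (hVo.preimage (α.continuous.comp (continuous_const_mul y⁻¹))).isClosed_compl
  obtain ⟨x, hx⟩ := IsCompact.nonempty_iInter_of_sequence_nonempty_isCompact_isClosed C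
    (fun n _ hx => ⟨fun k hk => hx.1 k (hk.trans n.le_succ), hx.2⟩)
    (fun n => by
      obtain ⟨x, hx, h⟩ := hne n
      exact ⟨x, hx, Set.mem_iInter₂.2 h⟩)
    (hVc.of_isClosed_subset (hclosed 0) fun y hy => truncation_le α V 0 hy.1) hclosed
  rw [Set.mem_iInter] at hx
  have hxp : x ∈ plus α V := mem_plus.2 fun k => (hx k).1 k le_rfl
  -- The limit point lies in `V₊`, so it may serve as its own `y`.
  refine Set.mem_iInter₂.1 (hx 0).2 x hxp ?_
  rw [inv_mul_cancel, map_one]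
  exact V.one_mem

/-- Left corrections from `V₊` keep the forward orbit of `x` in `V` for ever longer times; a limit
of the corrections in the compact `V₊` keeps it there forever. -/
lemma exists_tidyAbove_truncation (α : G ≃ₜ* G) {V : Subgroup G}
    (hVc : IsCompact (V : Set G)) (hVo : IsOpen (V : Set G)) :
    ∃ n, TidyAbove α (truncation α V n) := by
  obtain ⟨n, hn⟩ := exists_truncation_subset α hVc hVo
  have hfin (x : G) (hx : x ∈ truncation α V n) (m : ℕ) :
      ∃ y ∈ plus α V, ∀ j ≤ m, α^[j] (y⁻¹ * x) ∈ V := by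
    induction m with
    | zero =>
      refine ⟨1, one_mem _, fun j hj => ?_⟩
      obtain rfl : j = 0 := by omega
      simpa using truncation_le α V n hx
    | succ m ih =>
      obtain ⟨y, hy, hyx⟩ := ih
      have hz : y⁻¹ * x ∈ truncation α V n :=
        mul_mem (inv_mem (plus_le_truncation α V n hy)) hx
      have hz' : α^[m] (y⁻¹ * x) ∈ truncation α V n := by
        intro k hk
        rcases le_total k m with h | h
        · rw [show α.symm^[k] (α^[m] (y⁻¹ * x)) = α^[m - k] (y⁻¹ * x) from
            iterate_iterate_symm_of_le α.symm h _]
          exact hyx _ (by omega)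
        · rw [show α.symm^[k] (α^[m] (y⁻¹ * x)) = α.symm^[k - m] (y⁻¹ * x) from
            iterate_iterate_symm_of_ge α.symm h _]
          exact hz _ (by omega)
      obtain ⟨w, hw, hwV⟩ := hn _ hz'
      -- The correction `w`, needed at time `m`, is pulled back to time `0`; since `w ∈ V₊`, times
      -- up to `m` are not spoiled.
      refine ⟨y * α.symm^[m] w, mul_mem hy (iterate_symm_mem_plus hw m), fun j hj => ?_⟩
      rw [mul_inv_rev, mul_assoc, iterate_map_mul, iterate_map_inv]
      rcases Nat.le_succ_iff.1 hj with h | rfl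
      · rw [iterate_iterate_symm_of_le α h]
        exact mul_mem (inv_mem (mem_plus.1 hw _)) (hyx j h)
      · rw [Function.iterate_succ_apply', iterate_iterate_symm, Function.iterate_succ_apply',
          ← map_inv, ← map_mul]
        exact hwV
  refine ⟨n, Set.Subset.antisymm (fun x hx => ?_) ?_⟩
  · let C : ℕ → Set G := fun m =>
      plus α V ∩ ⋂ j ∈ Set.Iic m, {y | α^[j] (y⁻¹ * x) ∈ V}
    have hclosed (m : ℕ) : IsClosed (C m) := by
      refine (isClosed_plus α hVc.isClosed).inter (isClosed_biInter fun j _ => ?_)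
      exact hVc.isClosed.preimage
        ((continuous_iterate α j).comp (continuous_inv.mul continuous_const))
    obtain ⟨y, hy⟩ := IsCompact.nonempty_iInter_of_sequence_nonempty_isCompact_isClosed C
      (fun m y hy => ⟨hy.1, Set.mem_iInter₂.2 fun j hj =>
        Set.mem_iInter₂.1 hy.2 j (le_trans hj m.le_succ)⟩)
      (fun m => by
        obtain ⟨y, hy, h⟩ := hfin x hx m
        exact ⟨y, hy, Set.mem_iInter₂.2 h⟩)
      (hVc.of_isClosed_subset (hclosed 0) fun y hy => plus_le α V hy.1) hclosed
    rw [Set.mem_iInter] at hy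
    have hyp : y ∈ plus α V := (hy 0).1
    refine ⟨y, by rwa [plus_truncation], y⁻¹ * x, ?_, mul_inv_cancel_left y x⟩
    have hz : y⁻¹ * x ∈ truncation α V n := mul_mem (inv_mem (plus_le_truncation α V n hyp)) hx
    refine mem_minus.2 fun j k hk => ?_
    rcases le_total k j with h | h
    · rw [show α.symm^[k] (α^[j] (y⁻¹ * x)) = α^[j - k] (y⁻¹ * x) from
        iterate_iterate_symm_of_le α.symm h _]
      exact Set.mem_iInter₂.1 (hy (j - k)).2 _ Set.self_mem_Iic
    · rw [show α.symm^[k] (α^[j] (y⁻¹ * x)) = α.symm^[k - j] (y⁻¹ * x) from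
        iterate_iterate_symm_of_ge α.symm h _]
      exact hz _ (by omega)
  · rintro _ ⟨a, ha, b, hb, rfl⟩
    exact mul_mem (plus_le _ _ ha) (minus_le _ _ hb)

/-- A compact open subgroup that is tidy below contains a tidy one. -/
lemma TidyBelow.exists_tidy_le {α : G ≃ₜ* G} {V : Subgroup G} (h : TidyBelow α V)
    (hVc : IsCompact (V : Set G)) (hVo : IsOpen (V : Set G)) :
    ∃ U ≤ V, IsCompact (U : Set G) ∧ IsOpen (U : Set G) ∧ Tidy α U := by
  obtain ⟨n, hn⟩ := exists_tidyAbove_truncation α hVc hVo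
  exact ⟨truncation α V n, truncation_le α V n,
    hVc.of_isClosed_subset (isClosed_truncation α hVc.isClosed n) (truncation_le α V n),
    isOpen_truncation α hVo n, hn, h.tidyBelow_truncation n⟩

/-- If a compact open subgroup contains the nub, it contains a tidy subgroup. -/
lemma exists_tidy_le_of_nub_le {α : G ≃ₜ* G} {V : Subgroup G}
    (hVc : IsCompact (V : Set G)) (hVo : IsOpen (V : Set G)) (hV : nub α ≤ V) :
    ∃ U ≤ V, IsCompact (U : Set G) ∧ IsOpen (U : Set G) ∧ Tidy α U := by
  let S : Set (Subgroup G) := {U | IsCompact (U : Set G) ∧ IsOpen (U : Set G) ∧ TidyBelow α U}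
  suffices ∃ U ∈ S, U ≤ V by
    obtain ⟨U, ⟨hUc, hUo, hU⟩, hUV⟩ := this
    obtain ⟨W, hW, h⟩ := hU.exists_tidy_le hUc hUo
    exact ⟨W, hW.trans hUV, h⟩
  by_cases hS : S.Nonempty
  · have : Nonempty S := hS.to_subtype
    have hdir : Directed (· ⊇ ·) fun U : S => ((U : Subgroup G) : Set G) := by
      rintro ⟨A, hAc, hAo, hA⟩ ⟨B, hBc, hBo, hB⟩
      exact ⟨⟨A ⊓ B, hAc.inter hBc, hAo.inter hBo, hA.inf hB⟩, Set.inter_subset_left,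
        Set.inter_subset_right⟩
    obtain ⟨U, hU⟩ := exists_subset_nhds_of_isCompact hdir (fun U => U.2.1)
      (U := (V : Set G)) fun x hx => hVo.mem_nhds <| hV <| Subgroup.mem_sInf.2 fun U hU =>
        Set.mem_iInter.1 hx ⟨U, hU.1, hU.2.1, hU.2.2.2⟩
    exact ⟨U, U.2, hU⟩
  -- Here the nub is an empty infimum, so it is `⊤`.
  · have htop : V = ⊤ := by
      refine top_le_iff.1 (le_trans (fun x _ => Subgroup.mem_sInf.2 fun U hU => ?_) hV)
      exact absurd ⟨U, hU.1, hU.2.1, hU.2.2.2⟩ hS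
    exact ⟨V, ⟨hVc, hVo, htop ▸ tidyBelow_top α⟩, le_rfl⟩

end TidyingAbove

/-! ### Tidiness below passes to larger compact subgroups. -/

section TidyBelow

/-- In a locally compact group that is an increasing union of a sequence of closed
subgroups, every compact set lies in one of them. -/
lemma exists_subset_of_iUnion_closed_subgroups {H : Type*} [Group H] [TopologicalSpace H]
    [IsTopologicalGroup H] [LocallyCompactSpace H] {E : ℕ → Subgroup H}
    (hmono : Monotone E) (hclosed : ∀ n, IsClosed (E n : Set H))
    (hunion : ∀ x, ∃ n, x ∈ E n) {K : Set H} (hK : IsCompact K) : ∃ n, K ⊆ E n := by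
  -- By Baire some `E n` has interior, so all later ones are open subgroups.
  obtain ⟨n, x, hx⟩ := nonempty_interior_of_iUnion_of_closed hclosed
    (Set.eq_univ_of_forall fun x => Set.mem_iUnion.2 (hunion x))
  have hopen (m : ℕ) : IsOpen (E (max n m) : Set H) :=
    Subgroup.isOpen_of_mem_nhds _ (g := x) <| Filter.mem_of_superset
      (mem_interior_iff_mem_nhds.1 hx) (hmono (le_max_left n m))
  obtain ⟨m, hm⟩ := hK.elim_directed_cover (fun m => (E (max n m) : Set H)) hopen
    (fun y _ => Set.mem_iUnion.2 <| by
      obtain ⟨m, hm⟩ := hunion y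
      exact ⟨m, hmono (le_max_right n m) hm⟩)
    (Monotone.directed_le fun a b hab => hmono (max_le_max le_rfl hab))
  exact ⟨_, hm⟩

variable {G : Type*} [Group G] [TopologicalSpace G] [IsTopologicalGroup G]
  [LocallyCompactSpace G]

/-- If `U₋₋` is closed, an element of `U₋₋` with eventually bounded backward orbit has its whole
backward orbit in `U`. -/
lemma iterate_symm_mem_of_bounded {α : G ≃ₜ* G} {U : Subgroup G} (hUc : IsClosed (U : Set G))
    (hU : IsClosed (minusMinus α U)) {u : G} (hu : u ∈ minus α U) {K : Set G} (hK : IsCompact K)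
    {n : ℕ} (hn : ∀ k ≥ n, α.symm^[k] u ∈ K) (i : ℕ) : α.symm^[i] u ∈ U := by
  have hcl : IsClosed (minusMinusSubgroup α U : Set G) := by rwa [coe_minusMinusSubgroup]
  have : LocallyCompactSpace (minusMinusSubgroup α U) :=
    hcl.isClosedEmbedding_subtypeVal.locallyCompactSpace
  obtain ⟨m, hm⟩ := exists_subset_of_iUnion_closed_subgroups
    (E := fun m => (eventuallyIn α U m).subgroupOf (minusMinusSubgroup α U))
    (fun a b hab x hx => eventuallyIn_mono α U hab hx)
    (fun m => (isClosed_eventuallyIn α hUc m).preimage continuous_subtype_val)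
    (fun x => mem_minusMinusSubgroup.1 x.2)
    (hcl.isClosedEmbedding_subtypeVal.isCompact_preimage hK)
  have hmem (k : ℕ) : α.symm^[k] u ∈ minusMinusSubgroup α U :=
    mem_minusMinusSubgroup.2 ⟨k, fun j hj => by
      rw [iterate_iterate_symm_of_ge α hj]; exact mem_minus.1 hu _⟩
  -- Going back `m + n` further steps lands in `K`; coming forward as many, at least `m`, lands in
  -- `U`.
  have h : α.symm^[i + (m + n)] u ∈ eventuallyIn α U m :=
    @hm ⟨_, hmem (i + (m + n))⟩ (hn _ (by omega))
  have := h (m + n) (by omega)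
  rwa [iterate_iterate_symm_of_le α (by omega), Nat.add_sub_cancel] at this

variable [T2Space G]

/-- Write `x = a * u` in `U₊ U₋`. The backward orbit of `u` is eventually in the compact set `U *
V`, which forces `u ∈ U₊`. -/
lemma Tidy.plusPlus_inter_subset {α : G ≃ₜ* G} {U V : Subgroup G} (hU : Tidy α U)
    (hUc : IsCompact (U : Set G)) (hVc : IsCompact (V : Set G)) :
    plusPlus α V ∩ U ⊆ plus α U := by
  rintro x ⟨hxV, hxU⟩
  obtain ⟨n, hn⟩ := mem_plusPlus.1 hxV
  rw [hU.1] at hxU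
  obtain ⟨a, ha, u, hu, rfl⟩ := hxU
  have key := iterate_symm_mem_of_bounded hUc.isClosed hU.2.2 hu (hUc.mul hVc) (n := n)
    fun k hk => ⟨(α.symm^[k] a)⁻¹, inv_mem (mem_plus.1 ha k), _, hn k hk, by
      simp only [iterate_map_mul, inv_mul_cancel_left]⟩
  exact mul_mem ha (mem_plus.2 key)

lemma Tidy.isClosed_plusPlus_of_le {α : G ≃ₜ* G} {U V : Subgroup G} (hU : Tidy α U)
    (hUc : IsCompact (U : Set G)) (hUo : IsOpen (U : Set G)) (hVc : IsCompact (V : Set G))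
    (hUV : U ≤ V) : IsClosed (plusPlus α V) := by
  have hcoe : plusPlus α V = (minusMinusSubgroup α.symm V : Set G) := by
    rw [coe_minusMinusSubgroup, minusMinus_symm]
  have hsub := hU.plusPlus_inter_subset hUc hVc
  rw [hcoe] at hsub ⊢
  refine isClosed_of_closure_subset fun x hx => ?_
  -- Translating by `h ∈ V₊₊` moves the limit point into `U`, where the closure of `V₊₊` stays
  -- inside `U₊`.
  obtain ⟨h, hhU, hh⟩ := mem_closure_iff.1 hx {y | y⁻¹ * x ∈ U}
    (hUo.preimage (continuous_inv.mul continuous_const)) (by simp)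
  have hcl : h⁻¹ * x ∈ closure (minusMinusSubgroup α.symm V : Set G) :=
    (minusMinusSubgroup α.symm V).topologicalClosure.mul_mem
      (Subgroup.le_topologicalClosure _ (inv_mem hh)) hx
  have hplus : h⁻¹ * x ∈ plus α U :=
    closure_minimal hsub (isClosed_plus α hUc.isClosed) <|
      hUo.closure_inter ⟨hcl, hhU⟩
  have hV : h⁻¹ * x ∈ minusMinusSubgroup α.symm V :=
    mem_minusMinusSubgroup.2 ⟨0, fun k _ => hUV (mem_plus.1 hplus k)⟩
  simpa using mul_mem hh hV

lemma Tidy.tidyBelow_of_le {α : G ≃ₜ* G} {U V : Subgroup G} (hU : Tidy α U)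
    (hUc : IsCompact (U : Set G)) (hUo : IsOpen (U : Set G)) (hVc : IsCompact (V : Set G))
    (hUV : U ≤ V) : TidyBelow α V := by
  refine ⟨hU.isClosed_plusPlus_of_le hUc hUo hVc hUV, ?_⟩
  rw [← plusPlus_symm]
  exact hU.symm.isClosed_plusPlus_of_le hUc hUo hVc hUV

lemma tidyBelow_iff_nub_le (α : G ≃ₜ* G) {V : Subgroup G}
    (hVc : IsCompact (V : Set G)) (hVo : IsOpen (V : Set G)) : TidyBelow α V ↔ nub α ≤ V := by
  constructor
  · intro h
    obtain ⟨U, hUV, hU⟩ := h.exists_tidy_le hVc hVo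
    exact le_trans (sInf_le hU) hUV
  · intro h
    obtain ⟨U, hUV, hUc, hUo, hU⟩ := exists_tidy_le_of_nub_le hVc hVo h
    exact hU.tidyBelow_of_le hUc hUo hVc hUV

end TidyBelow

end TDLC

theorem corollary4p3 {G : Type*} [Group G] [TopologicalSpace G] [IsTopologicalGroup G]
    [LocallyCompactSpace G] [TotallyDisconnectedSpace G] (α : G ≃ₜ* G) (V : Subgroup G)
    (hVc : IsCompact (V : Set G)) (hVo : IsOpen (V : Set G)) :
    (TDLC.TidyBelow α V ↔ TDLC.nub α ≤ V) ∧
      (TDLC.nub α ≤ V → TDLC.TidyAbove α V → TDLC.Tidy α V) := by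
  have h := TDLC.tidyBelow_iff_nub_le α hVc hVo
  exact ⟨h, fun hV ha => ⟨ha, h.2 hV⟩⟩
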